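/- Let $\mathcal{L}=\{l_1<l_2<\cdots<l_s\}$ be a set of $s\ge 1$ nonnegative integers, let $n>s$, and let $\mathcal{A}$ be a family of (distinct) subsets of $[n]=\{1,\dots,n\}$ which is $\mathcal{L}$-intersecting, that is, $|E\cap F|\in\mathcal{L}$ for any two distinct members $E,F$ of $\mathcal{A}$. Suppose that $|E|\notin\mathcal{L}$ for every $E\in\mathcal{A}$, and let $k=\max_{E\in\mathcal{A}}|E|$ (with $k=0$ if $\mathcal{A}$ is empty). If $$n\ \ge\ \binom{k^{2}}{l_1+1}\,s+l_1,$$ then $$|\mathcal{A}|\le\binom{n}{s}.$$ -/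

import Mathlib

/-- A family `A` of subsets of `[n]` is `L`-intersecting if `|E ∩ F| ∈ L` for every pair of
distinct members `E`, `F` of `A`. -/
def IsLIntersecting {n : ℕ} (L : Finset ℕ) (A : Finset (Finset (Fin n))) : Prop :=
  ∀ E ∈ A, ∀ F ∈ A, E ≠ F → (E ∩ F).card ∈ L

/-- The maximum size of a member of the family `A` (it is `0` for the empty family). -/
def maxMemberSize {n : ℕ} (A : Finset (Finset (Fin n))) : ℕ :=
  A.sup Finset.card

/-! Write l = min L, s = |L| and N = n - l. The engine is the polynomial method: members containing
a common set T give independent multilinear polynomials in the coordinates outside T, and only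
values of L that are at least |T| and below the size of the member count towards the degree. Fixing
l + 1 points discards the value l, so a given (l+1)-set lies in at most Σ_{i<s} C(N-1, i) members,
roughly s C(N, s) / N.

Either all members share an l-set C, or l ≥ 1 and a set X of at most k² points meets each member in
more than l points (`exists_common_subset_or_exists_transversal`). In the second case A is covered
by C(k², l+1) ≤ N / s subfamilies, each fixing l + 1 points. In the first, an interval L is settled
by an injection into s-sets. Otherwise, double counting gives roughly at most s/(s+1) · C(N, s)
members with more than s points outside C, and the remaining members are of lower order since some
value of L is not below their sizes. -/

/-! ### Multilinear polynomials and the independence bound. -/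

section MultilinearMethod

theorem card_filter_powerset_card_le {α : Type*} (W : Finset α) (d : ℕ) :
    (W.powerset.filter fun I => I.card ≤ d).card = ∑ i ∈ Finset.range (d + 1), W.card.choose i := by
  rw [Finset.card_eq_sum_card_fiberwise (f := Finset.card) (t := Finset.range (d + 1))]
  · refine Finset.sum_congr rfl fun i hi => ?_
    rw [← Finset.card_powersetCard]
    congr 1
    ext I
    simp only [Finset.mem_filter, Finset.mem_powerset, Finset.mem_powersetCard, Finset.mem_range]
      at hi ⊢
    constructor
    · rintro ⟨⟨h1, _⟩, h3⟩
      exact ⟨h1, h3⟩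
    · rintro ⟨h1, h3⟩
      exact ⟨⟨h1, by omega⟩, h3⟩
  · intro I hI
    simp at hI ⊢
    omega

variable {α : Type*} [DecidableEq α]

/-- The multilinear monomial with variables indexed by `I`, as a function on the subsets of `α`. -/
def subsetMonomial (I : Finset α) : Finset α → ℚ := fun S => if I ⊆ S then 1 else 0

/-- The multilinear polynomials of degree at most `d` in the variables indexed by `W`. -/
def multilinearSpan (W : Finset α) (d : ℕ) : Submodule ℚ (Finset α → ℚ) :=
  Submodule.span ℚ (subsetMonomial '' {I | I ⊆ W ∧ I.card ≤ d})

theorem multilinearSpan_mono (W : Finset α) {d e : ℕ} (h : d ≤ e) :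
    multilinearSpan W d ≤ multilinearSpan W e :=
  Submodule.span_mono (Set.image_mono fun _ hI => ⟨hI.1, hI.2.trans h⟩)

/-- On 0/1 vectors x_j² = x_j, so products stay multilinear. -/
theorem subsetMonomial_mul (I J : Finset α) :
    subsetMonomial I * subsetMonomial J = subsetMonomial (I ∪ J) := by
  ext S
  simp only [subsetMonomial, Pi.mul_apply, Finset.union_subset_iff]
  split_ifs <;> simp_all

theorem mul_subsetMonomial_singleton_mem {W : Finset α} {d : ℕ} {f : Finset α → ℚ}
    (hf : f ∈ multilinearSpan W d) {j : α} (hj : j ∈ W) :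
    f * subsetMonomial {j} ∈ multilinearSpan W (d + 1) := by
  induction hf using Submodule.span_induction with
  | mem x hx =>
    obtain ⟨I, ⟨hI, hd⟩, rfl⟩ := hx
    rw [subsetMonomial_mul]
    refine Submodule.subset_span ⟨_, ⟨Finset.union_subset hI (by simpa using hj), ?_⟩, rfl⟩
    exact (Finset.card_union_le _ _).trans (by simpa using hd)
  | zero => simp
  | add x y _ _ hx hy => rw [add_mul]; exact add_mem hx hy
  | smul a x _ hx => rw [smul_mul_assoc]; exact Submodule.smul_mem _ _ hx

theorem prod_affine_mem_multilinearSpan {W U : Finset α} (hU : U ⊆ W) (P : Finset ℕ)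
    (c : ℕ → ℚ) :
    (∏ l ∈ P, (c l • (1 : Finset α → ℚ) + ∑ j ∈ U, subsetMonomial {j})) ∈
      multilinearSpan W P.card := by
  induction P using Finset.induction_on with
  | empty =>
    refine Submodule.subset_span ⟨∅, ⟨by simp, by simp⟩, ?_⟩
    ext S
    simp [subsetMonomial]
  | insert a P ha ih =>
    rw [Finset.prod_insert ha, Finset.card_insert_of_notMem ha, mul_comm, mul_add]
    refine add_mem ?_ ?_
    · rw [mul_smul_comm, mul_one]
      exact Submodule.smul_mem _ _ (multilinearSpan_mono W (Nat.le_succ _) ih)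
    · rw [Finset.mul_sum]
      exact Submodule.sum_mem _ fun j hj => mul_subsetMonomial_singleton_mem ih (hU hj)

theorem sum_subsetMonomial_singleton (U S : Finset α) :
    (∑ j ∈ U, subsetMonomial {j}) S = ((U ∩ S).card : ℚ) := by
  simp [subsetMonomial, Finset.sum_apply]

/-- Nonuniform Ray-Chaudhuri–Wilson bound for a family whose members contain a common set `T`. -/
theorem card_le_sum_choose_of_inter_mem [Fintype α] (L : Finset ℕ) (T : Finset α) (d : ℕ)
    (A : Finset (Finset α)) (hT : ∀ E ∈ A, T ⊆ E)
    (hA : ∀ E ∈ A, ∀ F ∈ A, E ≠ F → (E ∩ F).card ∈ L) (hsize : ∀ E ∈ A, E.card ∉ L)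
    (hd : ∀ E ∈ A, (L.filter fun l => T.card ≤ l ∧ l < E.card).card ≤ d) :
    A.card ≤ ∑ i ∈ Finset.range (d + 1), (Fintype.card α - T.card).choose i := by
  classical
  let P : Finset α → Finset ℕ := fun E => L.filter fun l => T.card ≤ l ∧ l < E.card
  -- The coordinates in T equal 1 on every member, so their contribution to |E ∩ F| is the constant
  -- |T|.
  let f : A → Finset α → ℚ := fun E =>
    ∏ l ∈ P E.1, (((T.card : ℚ) - l) • (1 : Finset α → ℚ) + ∑ j ∈ E.1 \ T, subsetMonomial {j})
  have hval : ∀ E F : A, f E F.1 = ∏ l ∈ P E.1, (((E.1 ∩ F.1).card : ℚ) - l) := by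
    intro E F
    simp only [f, Finset.prod_apply, Pi.add_apply, Pi.smul_apply, Pi.one_apply,
      sum_subsetMonomial_singleton]
    refine Finset.prod_congr rfl fun l _ => ?_
    have h : (E.1 ∩ F.1).card = T.card + ((E.1 \ T) ∩ F.1).card := by
      rw [← Finset.card_sdiff_add_card_eq_card
        (Finset.subset_inter (hT _ E.2) (hT _ F.2)), add_comm]
      congr 2
      ext x
      simp only [Finset.mem_sdiff, Finset.mem_inter]
      tauto
    rw [h]
    push_cast
    simp
    ring
  have hne : ∀ E : A, f E E.1 ≠ 0 := by
    intro E
    rw [hval, Finset.prod_ne_zero_iff]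
    intro l hl
    simp only [P, Finset.mem_filter] at hl
    rw [Finset.inter_self, sub_ne_zero]
    exact_mod_cast hl.2.2.ne'
  have hzero : ∀ E F : A, E ≠ F → f E F.1 = 0 := by
    intro E F hEF
    rw [hval]
    have hmem := hA _ E.2 _ F.2 (fun h => hEF (Subtype.ext h))
    refine Finset.prod_eq_zero (i := (E.1 ∩ F.1).card) ?_ (sub_self _)
    simp only [P, Finset.mem_filter]
    refine ⟨hmem, Finset.card_le_card (Finset.subset_inter (hT _ E.2) (hT _ F.2)), ?_⟩
    -- |E ∩ F| = |E| would put |E| in L.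
    refine lt_of_le_of_ne (Finset.card_le_card Finset.inter_subset_left) fun h => ?_
    exact hsize _ E.2 (h ▸ hmem)
  have hli : LinearIndependent ℚ f := by
    rw [Fintype.linearIndependent_iff]
    intro g hg E
    have h := congrFun hg E.1
    rw [Finset.sum_apply, Finset.sum_eq_single E] at h
    · simpa [hne E] using h
    · intro F _ hF
      simp [hzero F E hF]
    · simp
  have hspan : Set.range f ≤ Submodule.span ℚ
      (((Tᶜ.powerset.filter fun I => I.card ≤ d).image subsetMonomial : Finset _) :
        Set (Finset α → ℚ)) := by
    rintro _ ⟨E, rfl⟩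
    have h := multilinearSpan_mono Tᶜ (hd _ E.2)
      (prod_affine_mem_multilinearSpan (U := E.1 \ T) (W := Tᶜ)
        (by intro x; simp) (P E.1) (fun l => (T.card : ℚ) - l))
    rw [SetLike.mem_coe]
    simpa only [multilinearSpan, Finset.coe_image, Finset.coe_filter, Finset.mem_powerset] using h
  have h := linearIndependent_le_span_aux' f hli _ hspan
  rw [← Finset.card_compl, ← card_filter_powerset_card_le]
  refine le_trans ?_ (Finset.card_image_le (f := subsetMonomial))
  rwa [Fintype.card_coe, ← Set.toFinset_card, Finset.toFinset_coe] at h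

end MultilinearMethod
-- Binomial estimates.
section Binomial

/-- Going down from C(M, t), consecutive ratios are at most t / (M - t + 1); this is the sum of the
dominating geometric series. -/
theorem sum_range_choose_mul_le (M t : ℕ) (h : 2 * t ≤ M + 1) :
    ((∑ i ∈ Finset.range (t + 1), M.choose i : ℕ) : ℚ) * (M - 2 * t + 1) ≤
      M.choose t * (M - t + 1) := by
  induction t with
  | zero => simp
  | succ t ih =>
    have ih := ih (by omega)
    have hc : (M.choose (t + 1) : ℚ) * (t + 1) = M.choose t * (M - t) := by
      have := Nat.choose_succ_right_eq M t
      rw [← Nat.cast_sub (show t ≤ M by omega)]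
      exact_mod_cast this
    have hS : (M.choose t : ℚ) ≤ ((∑ i ∈ Finset.range (t + 1), M.choose i : ℕ) : ℚ) := by
      exact_mod_cast Finset.single_le_sum (f := fun i => M.choose i) (fun _ _ => Nat.zero_le _)
        (Finset.self_mem_range_succ t)
    rw [Finset.sum_range_succ]
    push_cast at *
    nlinarith

theorem choose_le_choose_of_add_le {n a b : ℕ} (hab : a ≤ b) (h : a + b ≤ n) :
    n.choose a ≤ n.choose b := by
  have key : ∀ c, a ≤ c → 2 * c ≤ n → n.choose a ≤ n.choose c := by
    intro c hc
    induction c, hc using Nat.le_induction with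
    | base => exact fun _ => le_rfl
    | succ c hc ih =>
      exact fun h2 => (ih (by omega)).trans (Nat.choose_le_succ_of_lt_half_left (by omega))
  rcases le_total (2 * b) n with h2 | h2
  · exact key b hab h2
  · rw [← Nat.choose_symm (show b ≤ n by omega)]
    exact key _ (by omega) (by omega)

theorem sq_le_choose_sq {k l : ℕ} (h : l < k) : k ^ 2 ≤ (k ^ 2).choose (l + 1) := by
  rcases Nat.lt_or_ge k 2 with hk | hk
  · obtain rfl : k = 1 := by omega
    obtain rfl : l = 0 := by omega
    simp
  · have := choose_le_choose_of_add_le (n := k ^ 2) (a := 1) (b := l + 1) (by omega) (by nlinarith)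
    simpa using this

theorem mul_sum_range_choose_le {N s : ℕ} (hs : 1 ≤ s) (h : 2 * s ≤ N) :
    (N : ℚ) * (∑ i ∈ Finset.range s, (N - 1).choose i : ℕ) * (N - 2 * s + 2) ≤
      s * N.choose s * (N - s + 1) := by
  obtain ⟨t, rfl⟩ : ∃ t, s = t + 1 := ⟨s - 1, by omega⟩
  obtain ⟨M, rfl⟩ : ∃ M, N = M + 1 := ⟨N - 1, by omega⟩
  have h1 := sum_range_choose_mul_le M t (by omega)
  have h2 : ((M : ℚ) + 1) * M.choose t = (M + 1).choose (t + 1) * (t + 1) := by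
    exact_mod_cast Nat.add_one_mul_choose_eq M t
  have h3 := mul_le_mul_of_nonneg_left h1 (show (0 : ℚ) ≤ (M : ℚ) + 1 by positivity)
  simp only [Nat.add_sub_cancel]
  push_cast at *
  linear_combination h3 + (M - t + 1) * h2

theorem core_numeric {N s a b : ℕ} (hs : 2 ≤ s) (hN : s * (s + 1) ^ 2 ≤ N)
    (ha : (s + 1) * a ≤ N * ∑ i ∈ Finset.range s, (N - 1).choose i)
    (hb : b ≤ ∑ i ∈ Finset.range s, N.choose i) : a + b ≤ N.choose s := by
  -- Exactly what the final comparison s(N-s+1) + 2s(s+1) ≤ (s+1)(N-2s+2) requires.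
  have hN' : 3 * s ^ 2 + 3 * s ≤ N + 2 := by nlinarith [mul_le_mul hs hs (by omega) (by omega)]
  have h2s : 4 * s ≤ N := by nlinarith
  have h1 := mul_sum_range_choose_le (N := N) (s := s) (by omega) (by omega)
  have hb' : (b : ℚ) * (N - s + 1) ≤ 2 * s * N.choose s := by
    obtain ⟨t, rfl⟩ : ∃ t, s = t + 1 := ⟨s - 1, by omega⟩
    have h2 := sum_range_choose_mul_le N t (by omega)
    have hc : (N.choose (t + 1) : ℚ) * (t + 1) = N.choose t * (N - t) := by
      have := Nat.choose_succ_right_eq N t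
      rw [← Nat.cast_sub (show t ≤ N by omega)]
      exact_mod_cast this
    have hbq : (b : ℚ) ≤ (∑ i ∈ Finset.range (t + 1), N.choose i : ℕ) := by exact_mod_cast hb
    have hNt : (4 : ℚ) * (t + 1) ≤ N := by exact_mod_cast h2s
    have h3 : (b : ℚ) ≤ 2 * N.choose t := by
      have hpos : (0 : ℚ) < N - 2 * t + 1 := by linarith [(Nat.cast_nonneg t : (0 : ℚ) ≤ t)]
      refine le_of_mul_le_mul_right ?_ hpos
      refine (mul_le_mul_of_nonneg_right hbq hpos.le).trans (h2.trans ?_)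
      have : (0 : ℚ) ≤ N.choose t := by positivity
      nlinarith [(Nat.cast_nonneg t : (0 : ℚ) ≤ t)]
    push_cast
    have : (0 : ℚ) ≤ N - t := by linarith [(Nat.cast_nonneg t : (0 : ℚ) ≤ t)]
    nlinarith
  have haq : ((s : ℚ) + 1) * a ≤ N * (∑ i ∈ Finset.range s, (N - 1).choose i : ℕ) := by
    exact_mod_cast ha
  have hsq : (2 : ℚ) ≤ s := by exact_mod_cast hs
  have hNq : (3 : ℚ) * s ^ 2 + 3 * s ≤ N + 2 := by exact_mod_cast hN'
  have hD : (0 : ℚ) < N - 2 * s + 2 := by nlinarith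
  have ha' : ((s : ℚ) + 1) * a * (N - 2 * s + 2) ≤ s * N.choose s * (N - s + 1) :=
    (mul_le_mul_of_nonneg_right haq hD.le).trans h1
  have hC : (0 : ℚ) ≤ N.choose s := by positivity
  have hb2 : (b : ℚ) * (N - 2 * s + 2) ≤ 2 * s * N.choose s :=
    (mul_le_mul_of_nonneg_left (by linarith) (by positivity)).trans hb'
  have hb3 := mul_le_mul_of_nonneg_left hb2 (show (0 : ℚ) ≤ s + 1 by positivity)
  have : (a : ℚ) + b ≤ N.choose s := by
    refine le_of_mul_le_mul_right ?_ (mul_pos hD (show (0 : ℚ) < s + 1 by positivity))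
    have h5 := mul_nonneg hC (sub_nonneg.2 hNq)
    nlinarith
  exact_mod_cast this

/-- The estimate exceeds C(N, s) by a factor (N-s+1)/(N-2s+2). Passing to C(N+1, s) absorbs it when
s² ≤ N + 1, hence the need for n > N, that is, l ≥ 1. -/
theorem noncore_numeric {N s n a q : ℕ} (hs : 1 ≤ s) (hN : s ^ 2 ≤ N) (h2 : 2 * s ≤ N)
    (hn : N + 1 ≤ n) (hq : q * s ≤ N)
    (ha : a ≤ q * ∑ i ∈ Finset.range s, (N - 1).choose i) : a ≤ n.choose s := by
  refine le_trans ?_ (Nat.choose_le_choose s hn)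
  have h1 := mul_sum_range_choose_le (N := N) (s := s) hs h2
  have ha' : (s : ℚ) * a ≤ N * (∑ i ∈ Finset.range s, (N - 1).choose i : ℕ) := by
    have : s * a ≤ N * ∑ i ∈ Finset.range s, (N - 1).choose i := by
      calc s * a ≤ s * (q * ∑ i ∈ Finset.range s, (N - 1).choose i) := by gcongr
        _ = (q * s) * ∑ i ∈ Finset.range s, (N - 1).choose i := by ring
        _ ≤ _ := by gcongr
    exact_mod_cast this
  have hsq : (1 : ℚ) ≤ s := by exact_mod_cast hs
  have hNq : (s : ℚ) ^ 2 ≤ N := by exact_mod_cast hN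
  have h2q : (2 : ℚ) * s ≤ N := by exact_mod_cast h2
  have hD : (0 : ℚ) < N - 2 * s + 2 := by linarith
  have hD' : (0 : ℚ) < N - s + 1 := by linarith
  have hC : (0 : ℚ) ≤ N.choose s := by positivity
  have h3 : (a : ℚ) * (N - 2 * s + 2) ≤ N.choose s * (N - s + 1) := by
    refine le_of_mul_le_mul_left ?_ (show (0 : ℚ) < s by linarith)
    nlinarith [mul_le_mul_of_nonneg_right ha' hD.le]
  have hc : ((N + 1).choose s : ℚ) * (N - s + 1) = N.choose s * (N + 1) := by
    have := Nat.choose_mul_succ_eq N s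
    have h' : ((N + 1 - s : ℕ) : ℚ) = N - s + 1 := by
      rw [Nat.cast_sub (by omega)]; push_cast; ring
    rw [← h']
    exact_mod_cast this.symm
  have : (a : ℚ) ≤ (N + 1).choose s := by
    refine le_of_mul_le_mul_right ?_ (mul_pos hD hD')
    have h4 := mul_le_mul_of_nonneg_right h3 hD'.le
    have h5 : (N.choose s : ℚ) * ((N - s + 1) * (N - s + 1)) ≤
        N.choose s * ((N + 1) * (N - 2 * s + 2)) :=
      mul_le_mul_of_nonneg_left (by nlinarith) hC
    linear_combination h4 + h5 - (N - 2 * s + 2) * hc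
  exact_mod_cast this

end Binomial

/-! ### Structure of the family and the two cases. -/

section Families

variable {n : ℕ} {L : Finset ℕ} {A : Finset (Finset (Fin n))}

theorem IsLIntersecting.mono (hA : IsLIntersecting L A) {B : Finset (Finset (Fin n))}
    (h : B ⊆ A) : IsLIntersecting L B :=
  fun E hE F hF => hA E (h hE) F (h hF)

/-- The number of members containing a set larger than the least intersection size. -/
theorem IsLIntersecting.card_filter_superset_le (hA : IsLIntersecting L A)
    (hsize : ∀ E ∈ A, E.card ∉ L) {l : ℕ} (hl : l ∈ L) (T : Finset (Fin n))
    (hT : T.card = l + 1) :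
    (A.filter fun E => T ⊆ E).card ≤
      ∑ i ∈ Finset.range L.card, (n - l - 1).choose i := by
  have hpos : 0 < L.card := Finset.card_pos.2 ⟨l, hl⟩
  have h := card_le_sum_choose_of_inter_mem L T (L.card - 1) (A.filter fun E => T ⊆ E)
    (fun E hE => (Finset.mem_filter.1 hE).2) (hA.mono (Finset.filter_subset _ _))
    (fun E hE => hsize E (Finset.mem_filter.1 hE).1) (fun E _ => by
      rw [← Finset.card_erase_of_mem hl]
      refine Finset.card_le_card fun x hx => ?_
      rw [Finset.mem_filter, hT] at hx
      exact Finset.mem_erase.2 ⟨by omega, hx.1⟩)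
  rwa [Nat.sub_add_cancel hpos, Fintype.card_fin, hT, ← Nat.sub_sub] at h

/-- If some two members share just `l` points but not all members share those points, then three
members cover a set meeting every member in more than `l` points. -/
theorem exists_common_subset_or_exists_transversal {l k : ℕ} (hk : l < k)
    (hA : ∀ E ∈ A, ∀ F ∈ A, l ≤ (E ∩ F).card) (hl : ∀ E ∈ A, l < E.card)
    (hcard : ∀ E ∈ A, E.card ≤ k) :
    (∃ C : Finset (Fin n), C.card = l ∧ ∀ E ∈ A, C ⊆ E) ∨
      1 ≤ l ∧ ∃ X : Finset (Fin n), X.card ≤ k ^ 2 ∧ ∀ E ∈ A, l + 1 ≤ (E ∩ X).card := by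
  rcases Nat.eq_zero_or_pos l with rfl | hl0
  · exact Or.inl ⟨∅, by simp⟩
  by_cases h : ∃ E ∈ A, ∃ F ∈ A, (E ∩ F).card ≤ l
  · obtain ⟨E, hE, F, hF, hEF⟩ := h
    have hEF' := hA E hE F hF
    by_cases hC : ∀ G ∈ A, E ∩ F ⊆ G
    · exact Or.inl ⟨E ∩ F, by omega, hC⟩
    push Not at hC
    obtain ⟨G, hG, hGC⟩ := hC
    refine Or.inr ⟨hl0, E ∪ F ∪ G, ?_, fun H hH => ?_⟩
    · have h1 := Finset.card_union_add_card_inter E F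
      have h2 := Finset.card_union_add_card_inter (E ∪ F) G
      have h3 : (E ∩ G).card ≤ ((E ∪ F) ∩ G).card :=
        Finset.card_le_card (Finset.inter_subset_inter_right Finset.subset_union_left)
      have h4 := hA E hE G hG
      have h5 := hcard E hE
      have h6 := hcard F hF
      have h7 := hcard G hG
      -- As l ≥ 1, the overlaps leave at most 3k - 2 points in the union, and (k-1)(k-2) ≥ 0.
      have h8 : 3 * k ≤ k ^ 2 + 2 := by
        obtain ⟨j, rfl⟩ : ∃ j, k = j + 2 := ⟨k - 2, by omega⟩
        nlinarith
      omega
    · by_contra hlt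
      -- If H meets the union in only l points, those points are H ∩ K for each of the three sets K.
      -- They then form E ∩ F and lie in G, a contradiction.
      have sub : ∀ K ∈ A, K ⊆ E ∪ F ∪ G → H ∩ (E ∪ F ∪ G) ⊆ K := by
        intro K hK hKX
        have h1 : H ∩ K ⊆ H ∩ (E ∪ F ∪ G) := Finset.inter_subset_inter_left hKX
        have h2 := Finset.eq_of_subset_of_card_le h1 (by have := hA H hH K hK; omega)
        rw [← h2]
        exact Finset.inter_subset_right
      have hE' := sub E hE (by intro x; simp; tauto)
      have hF' := sub F hF (by intro x; simp; tauto)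
      have hG' := sub G hG Finset.subset_union_right
      have h1 : H ∩ (E ∪ F ∪ G) ⊆ E ∩ F := Finset.subset_inter hE' hF'
      have h2 : (H ∩ E).card ≤ (H ∩ (E ∪ F ∪ G)).card :=
        Finset.card_le_card (Finset.inter_subset_inter_left (by intro x; simp; tauto))
      have h3 := hA H hH E hE
      exact hGC (Finset.eq_of_subset_of_card_le h1 (by omega) ▸ hG')
  · push Not at h
    rcases A.eq_empty_or_nonempty with rfl | ⟨E, hE⟩
    · exact Or.inr ⟨hl0, ∅, by simp⟩
    · refine Or.inr ⟨hl0, E, (hcard E hE).trans (by nlinarith), fun F hF => h F hF E hE⟩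

theorem card_le_of_transversal {l k : ℕ} (hl0 : 1 ≤ l) (hk : l < k) (hA : IsLIntersecting L A)
    (hsize : ∀ E ∈ A, E.card ∉ L) (hl : l ∈ L) (hs : L.card ≤ k)
    (hn : (k ^ 2).choose (l + 1) * L.card + l ≤ n)
    {X : Finset (Fin n)} (hX : X.card ≤ k ^ 2) (hAX : ∀ E ∈ A, l + 1 ≤ (E ∩ X).card) :
    A.card ≤ n.choose L.card := by
  have hpos : 1 ≤ L.card := Finset.card_pos.2 ⟨l, hl⟩
  have hc := sq_le_choose_sq hk
  have hks : k ^ 2 * L.card ≤ n - l :=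
    (Nat.mul_le_mul_right _ hc).trans (Nat.le_sub_of_add_le hn)
  refine noncore_numeric (N := n - l) hpos ?_ ?_ (by omega) (Nat.le_sub_of_add_le hn) ?_
  · nlinarith
  · nlinarith
  · have hsub : A ⊆ (X.powersetCard (l + 1)).biUnion fun T => A.filter fun E => T ⊆ E := by
      intro E hE
      obtain ⟨T, hT, hTc⟩ := Finset.exists_subset_card_eq (hAX E hE)
      simp only [Finset.mem_biUnion, Finset.mem_powersetCard, Finset.mem_filter]
      exact ⟨T, ⟨hT.trans Finset.inter_subset_right, hTc⟩, hE, hT.trans Finset.inter_subset_left⟩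
    refine (Finset.card_le_card hsub).trans ((Finset.card_biUnion_le_card_mul _ _ _
      fun T hT => hA.card_filter_superset_le hsize hl T (Finset.mem_powersetCard.1 hT).2).trans ?_)
    rw [Finset.card_powersetCard]
    exact Nat.mul_le_mul_right _ (Nat.choose_le_choose _ hX)

/-- Any s points of E outside C determine E: two members with the same choice would share l + s
points. -/
theorem card_le_choose_of_consecutive {l s : ℕ} {C : Finset (Fin n)} (hC : C.card = l)
    (hAC : ∀ E ∈ A, C ⊆ E) (hA : ∀ E ∈ A, ∀ F ∈ A, E ≠ F → (E ∩ F).card < l + s)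
    (hsize : ∀ E ∈ A, l + s ≤ E.card) : A.card ≤ (n - l).choose s := by
  have hex : ∀ E ∈ A, ∃ S ⊆ E \ C, S.card = s := fun E hE =>
    Finset.exists_subset_card_eq (by
      rw [Finset.card_sdiff_of_subset (hAC E hE)]
      have := hsize E hE
      omega)
  choose! g hg hgc using hex
  have h : A.card ≤ (Cᶜ.powersetCard s).card := by
    refine Finset.card_le_card_of_injOn g (fun E hE => ?_) fun E hE F hF hEF => ?_
    · rw [Finset.mem_coe, Finset.mem_powersetCard]
      refine ⟨fun x hx => ?_, hgc E hE⟩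
      simpa using (Finset.mem_sdiff.1 (hg E hE hx)).2
    · by_contra hne
      have h1 := hA E hE F hF hne
      have h2 : C ∪ g E ⊆ E ∩ F := by
        refine Finset.union_subset (Finset.subset_inter (hAC E hE) (hAC F hF))
          (Finset.subset_inter ((hg E hE).trans Finset.sdiff_subset) ?_)
        rw [hEF]
        exact (hg F hF).trans Finset.sdiff_subset
      have h3 := Finset.card_le_card h2
      rw [Finset.card_union_of_disjoint
        (Finset.disjoint_sdiff.mono_right (hg E hE)), hC, hgc E hE] at h3
      omega
  rwa [Finset.card_powersetCard, Finset.card_compl, Fintype.card_fin, hC] at h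

theorem sum_card_filter_insert {C : Finset (Fin n)} (B : Finset (Finset (Fin n)))
    (hB : ∀ E ∈ B, C ⊆ E) :
    ∑ x ∈ Cᶜ, (B.filter fun E => insert x C ⊆ E).card = ∑ E ∈ B, (E \ C).card := by
  simp only [Finset.card_filter]
  rw [Finset.sum_comm]
  refine Finset.sum_congr rfl fun E hE => ?_
  rw [← Finset.card_filter]
  congr 1
  ext x
  simp only [Finset.mem_filter, Finset.mem_compl, Finset.insert_subset_iff, Finset.mem_sdiff]
  have := hB E hE
  tauto

theorem card_le_of_common_subset {l k : ℕ} (hk : l < k) (hA : IsLIntersecting L A)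
    (hsize : ∀ E ∈ A, E.card ∉ L) (hl : l ∈ L) (hmin : ∀ x ∈ L, l ≤ x) (hmax : ∀ x ∈ L, x < k)
    (hn : (k ^ 2).choose (l + 1) * L.card + l ≤ n)
    {C : Finset (Fin n)} (hC : C.card = l) (hAC : ∀ E ∈ A, C ⊆ E) :
    A.card ≤ n.choose L.card := by
  have hpos : 1 ≤ L.card := Finset.card_pos.2 ⟨l, hl⟩
  refine le_trans ?_ (Nat.choose_le_choose L.card (Nat.sub_le n l))
  by_cases hcon : L ⊆ Finset.Ico l (l + L.card)
  · have hL : L = Finset.Ico l (l + L.card) :=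
      Finset.eq_of_subset_of_card_le hcon (by simp)
    refine card_le_choose_of_consecutive hC hAC (fun E hE F hF h => ?_) fun E hE => ?_
    · exact (Finset.mem_Ico.1 (hcon (hA E hE F hF h))).2
    · by_contra hlt
      refine hsize E hE ?_
      rw [hL, Finset.mem_Ico]
      exact ⟨hC ▸ Finset.card_le_card (hAC E hE), by omega⟩
  obtain ⟨y, hy, hyL⟩ := Finset.not_subset.1 hcon
  have hyl := hmin y hy
  have hyk := hmax y hy
  have hys : l + L.card ≤ y := by
    by_contra h
    exact hyL (Finset.mem_Ico.2 ⟨hyl, by omega⟩)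
  have hs2 : 2 ≤ L.card := by
    have := Finset.one_lt_card.2 ⟨l, hl, y, hy, by omega⟩
    omega
  -- Here s + 1 ≤ k, because l + s ≤ y < k.
  have hN : L.card * (L.card + 1) ^ 2 ≤ n - l := by
    have hc := sq_le_choose_sq hk
    have h1 : (L.card + 1) ^ 2 ≤ k ^ 2 := Nat.pow_le_pow_left (by omega) 2
    calc L.card * (L.card + 1) ^ 2 ≤ L.card * (k ^ 2).choose (l + 1) :=
          Nat.mul_le_mul_left _ (h1.trans hc)
      _ ≤ n - l := by rw [mul_comm]; exact Nat.le_sub_of_add_le hn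
  rw [← Finset.card_filter_add_card_filter_not (s := A) (fun E => L.card + 1 ≤ (E \ C).card)]
  refine core_numeric hs2 hN ?_ ?_
  · set B := A.filter fun E => L.card + 1 ≤ (E \ C).card with hB
    calc (L.card + 1) * B.card = ∑ E ∈ B, (L.card + 1) := by simp [mul_comm]
      _ ≤ ∑ E ∈ B, (E \ C).card := Finset.sum_le_sum fun E hE => (Finset.mem_filter.1 hE).2
      _ = ∑ x ∈ Cᶜ, (B.filter fun E => insert x C ⊆ E).card :=
          (sum_card_filter_insert B fun E hE => hAC E (Finset.mem_filter.1 hE).1).symm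
      _ ≤ ∑ x ∈ Cᶜ, ∑ i ∈ Finset.range L.card, (n - l - 1).choose i := by
          refine Finset.sum_le_sum fun x hx => ?_
          refine (hA.mono (Finset.filter_subset _ _)).card_filter_superset_le
            (fun E hE => hsize E (Finset.mem_filter.1 hE).1) hl _ ?_
          rw [Finset.card_insert_of_notMem (Finset.mem_compl.1 hx), hC]
      _ = _ := by simp [Finset.card_compl, hC]
  · have h := card_le_sum_choose_of_inter_mem L C (L.card - 1)
      (A.filter fun E => ¬ L.card + 1 ≤ (E \ C).card)
      (fun E hE => hAC E (Finset.mem_filter.1 hE).1) (hA.mono (Finset.filter_subset _ _))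
      (fun E hE => hsize E (Finset.mem_filter.1 hE).1) (fun E hE => by
        -- These members have size at most l + s ≤ y, so y drops out of the degree count.
        rw [← Finset.card_erase_of_mem hy]
        refine Finset.card_le_card fun x hx => ?_
        rw [Finset.mem_filter] at hx hE
        have h1 := Finset.card_sdiff_add_card_eq_card (hAC E hE.1)
        refine Finset.mem_erase.2 ⟨?_, hx.1⟩
        rintro rfl
        have := hsize E hE.1
        omega)
    rwa [Nat.sub_add_cancel hpos, Fintype.card_fin, hC] at h

theorem card_le_choose_of_forall_lt (hL : L.Nonempty) {k : ℕ} (hmax : ∀ x ∈ L, x < k)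
    (hcard : ∀ E ∈ A, E.card ≤ k) (hA : IsLIntersecting L A) (hsize : ∀ E ∈ A, E.card ∉ L)
    (hn : (k ^ 2).choose (L.min' hL + 1) * L.card + L.min' hL ≤ n) (hA2 : 1 < A.card) :
    A.card ≤ n.choose L.card := by
  set l := L.min' hL
  have hl : l ∈ L := L.min'_mem hL
  have hmin : ∀ x ∈ L, l ≤ x := fun x hx => L.min'_le x hx
  have hk : l < k := hmax l hl
  have hbig : ∀ E ∈ A, l < E.card := by
    intro E hE
    obtain ⟨F, hF, hFE⟩ := Finset.exists_mem_ne hA2 E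
    have h1 := hmin _ (hA E hE F hF hFE.symm)
    have h2 : (E ∩ F).card ≤ E.card := Finset.card_le_card Finset.inter_subset_left
    refine lt_of_le_of_ne (h1.trans h2) fun h => hsize E hE (h ▸ hl)
  have hinter : ∀ E ∈ A, ∀ F ∈ A, l ≤ (E ∩ F).card := by
    intro E hE F hF
    by_cases h : E = F
    · rw [← h, Finset.inter_self]
      exact (hbig E hE).le
    · exact hmin _ (hA E hE F hF h)
  have hs : L.card ≤ k := by
    simpa using Finset.card_le_card (fun x hx => Finset.mem_range.2 (hmax x hx) :
      L ⊆ Finset.range k)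
  rcases exists_common_subset_or_exists_transversal hk hinter hbig hcard with
    ⟨C, hC, hAC⟩ | ⟨hl0, X, hX, hAX⟩
  · exact card_le_of_common_subset hk hA hsize hl hmin hmax hn hC hAC
  · exact card_le_of_transversal hl0 hk hA hsize hl hs hn hX hAX

end Families

/-! ### Reduction to intersection sizes below k. -/

theorem theorem1p9 (n : ℕ) (L : Finset ℕ) (hL : L.Nonempty)
    (A : Finset (Finset (Fin n)))
    (hsn : L.card < n)
    (hA : IsLIntersecting L A)
    (hsize : ∀ E ∈ A, E.card ∉ L)
    (hn : ((maxMemberSize A) ^ 2).choose (L.min' hL + 1) * L.card + L.min' hL ≤ n) :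
    A.card ≤ n.choose L.card := by
  rcases Nat.lt_or_ge 1 A.card with hA2 | hA1
  swap
  · exact hA1.trans (Nat.choose_pos hsn.le)
  set k := maxMemberSize A
  have hcard : ∀ E ∈ A, E.card ≤ k := fun E hE => Finset.le_sup (f := Finset.card) hE
  have hlt : ∀ E ∈ A, ∀ F ∈ A, E ≠ F → (E ∩ F).card < k := by
    intro E hE F hF hEF
    by_contra h
    have hE' := Finset.eq_of_subset_of_card_le (Finset.inter_subset_left (s₁ := E) (s₂ := F))
      (by have := hcard E hE; omega)
    have hF' := Finset.eq_of_subset_of_card_le (Finset.inter_subset_right (s₁ := E) (s₂ := F))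
      (by have := hcard F hF; omega)
    exact hEF (hE'.symm.trans hF')
  -- Values of L at or above k never occur, and discarding them keeps the minimum. Returning to C(n,
  -- s) needs the two cardinalities to sum to at most n.
  have hA' : IsLIntersecting (L.filter (· < k)) A := fun E hE F hF hEF =>
    Finset.mem_filter.2 ⟨hA E hE F hF hEF, hlt E hE F hF hEF⟩
  have hL' : (L.filter (· < k)).Nonempty := by
    obtain ⟨E, hE, F, hF, hEF⟩ := Finset.one_lt_card.1 hA2
    exact ⟨_, hA' E hE F hF hEF⟩
  have hle : (L.filter (· < k)).card ≤ L.card := Finset.card_filter_le _ _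
  have hmin : (L.filter (· < k)).min' hL' = L.min' hL := by
    refine le_antisymm (Finset.min'_le _ _ (Finset.mem_filter.2 ⟨L.min'_mem hL, ?_⟩))
      (Finset.min'_subset hL' (Finset.filter_subset _ _))
    obtain ⟨x, hx⟩ := hL'
    exact (L.min'_le x (Finset.mem_filter.1 hx).1).trans_lt (Finset.mem_filter.1 hx).2
  have hlk : L.min' hL < k := by
    have := (L.filter (· < k)).min'_mem hL'
    rw [hmin] at this
    exact (Finset.mem_filter.1 this).2
  refine (card_le_choose_of_forall_lt hL' (fun x hx => (Finset.mem_filter.1 hx).2) hcard hA'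
    (fun E hE h => hsize E hE (Finset.mem_filter.1 h).1) ?_ hA2).trans
    (choose_le_choose_of_add_le hle ?_)
  · rw [hmin]
    exact (Nat.add_le_add_right (Nat.mul_le_mul_left _ hle) _).trans hn
  -- For k ≤ 1 at most one value survives and s < n suffices; for k ≥ 2 the bound on n gives 2s ≤ n.
  · rcases Nat.lt_or_ge k 2 with hk | hk
    · have h1 : (L.filter (· < k)).card ≤ k := by
        simpa using Finset.card_le_card (fun x hx =>
          Finset.mem_range.2 (Finset.mem_filter.1 hx).2 : L.filter (· < k) ⊆ Finset.range k)
      omega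
    · have h1 : 2 ≤ (k ^ 2).choose (L.min' hL + 1) :=
        le_trans (by nlinarith) (sq_le_choose_sq hlk)
      have h2 := Nat.mul_le_mul_right L.card h1
      omega
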